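/- Let $H=\log(e^{A}e^{B})=\sum_{k\ge 1}\frac{(-1)^{k+1}}{k}\left(e^{A}e^{B}-1\right)^k$ be the Baker--Campbell--Hausdorff series in the ring $\mathbb{Q}\langle\langle A,B\rangle\rangle$ of formal power series with rational coefficients in the non-commuting variables $A$ and $B$, and for a word $w$ over $\{A,B\}$ let $\mathrm{coeff}(w,H)$ denote the coefficient of $w$ in $H$. For $r\in\mathbb{Q}$ let $\mathrm{denom}(r)$ be the smallest positive integer $d$ with $rd\in\mathbb{Z}$ (so $\mathrm{denom}(0)=1$). For $n\ge 1$ and a prime $p$ let $s_p(n)$ be the sum of the digits of $n$ in base $p$, let $$l(n,p)=\max\{t : p^t\le s_p(n)\}=\lfloor\log_p s_p(n)\rfloor,$$ and define $$d_n=\prod_{p\ \mathrm{prime},\ p<n}p^{\,l(n,p)}.$$ Then, for every $n\ge 1$, $n!\,d_n$ is the smallest common denominator of all coefficients of words of length $n$ in $H$, i.e. the smallest positive integer $D$ such that $D\cdot\mathrm{coeff}(w,H)\in\mathbb{Z}$ for all $w\in\{A,B\}^n$. Equivalently, $$\mathrm{lcm}\{\mathrm{denom}(\mathrm{coeff}(w,H))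 : w\in\{A,B\}^n\}=n!\,d_n.$$ Moreover, for every prime $p$ there is a word $w\in\{A,B\}^n$ with $$v_p(\mathrm{denom}(\mathrm{coeff}(w,H)))=v_p(n!)+l(n,p),$$ where $v_p(k)$ is the exponent of the highest power of $p$ dividing $k$. -/

import Mathlib

/-- The two non-commuting variables. -/
inductive Letter : Type
  | A : Letter
  | B : Letter
  deriving DecidableEq

instance : Fintype Letter := ⟨{Letter.A, Letter.B}, fun x => by cases x <;> simp⟩

/-- Formal power series over `ℚ` in the non-commuting variables `A`, `B`: a series assigns
a rational coefficient to every finite word in the letters `A` and `B`. -/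
structure NCSeries : Type where
  /-- The coefficient of a word. -/
  coeff : List Letter → ℚ

namespace NCSeries

/-- The series `1`, i.e. the empty word. -/
instance : One NCSeries := ⟨⟨fun w => if w = [] then 1 else 0⟩⟩

/-- Subtraction is coefficientwise. -/
instance : Sub NCSeries := ⟨fun F G => ⟨fun w => F.coeff w - G.coeff w⟩⟩

/-- The product extends concatenation of words: the coefficient of `w` in `F * G` is the sum of
`F.coeff u * G.coeff v` over all factorizations `w = u ++ v`. -/
instance : Mul NCSeries :=
  ⟨fun F G => ⟨fun w =>
    ∑ i ∈ Finset.range (w.length + 1), F.coeff (w.take i) * G.coeff (w.drop i)⟩⟩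

/-- Powers, `F ^ 0 = 1` and `F ^ (k + 1) = F ^ k * F`. -/
instance : Pow NCSeries ℕ := ⟨fun F k => npowRec k F⟩

/-- The variable `a`, i.e. the word consisting of the single letter `a`. -/
def X (a : Letter) : NCSeries := ⟨fun w => if w = [a] then 1 else 0⟩

/-- The exponential `∑_{k ≥ 0} F ^ k / k!` of a series `F` without constant term. For such an `F`
only finitely many `k` contribute to the coefficient of a given word. -/
noncomputable def exp (F : NCSeries) : NCSeries :=
  ⟨fun w => ∑ᶠ k : ℕ, (F ^ k).coeff w / (k.factorial : ℚ)⟩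

/-- The logarithm `∑_{k ≥ 1} (-1) ^ (k + 1) / k * (F - 1) ^ k` of a series `F` with constant
term `1`, with `k` shifted by one. For such an `F` only finitely many `k` contribute to the
coefficient of a given word. -/
noncomputable def log (F : NCSeries) : NCSeries :=
  ⟨fun w => ∑ᶠ k : ℕ, (-1 : ℚ) ^ k / ((k : ℚ) + 1) * ((F - 1) ^ (k + 1)).coeff w⟩

/-- The infinite sums in `exp` and `log` are locally finite: the `k`-th power of a series without
constant term has no words of length less than `k`. -/
theorem coeff_pow_eq_zero (F : NCSeries) (hF : F.coeff [] = 0) (k : ℕ) (w : List Letter)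
    (hw : w.length < k) : (F ^ k).coeff w = 0 := by
  induction k generalizing w with
  | zero => omega
  | succ k ih =>
    change ∑ i ∈ Finset.range (w.length + 1),
      (F ^ k).coeff (w.take i) * F.coeff (w.drop i) = 0
    refine Finset.sum_eq_zero fun i hi => ?_
    rw [Finset.mem_range] at hi
    by_cases h : i = w.length
    · rw [h, List.drop_length, hF, mul_zero]
    · rw [ih, zero_mul]
      rw [List.length_take]
      omega

theorem coeff_exp (F : NCSeries) (hF : F.coeff [] = 0) (w : List Letter) :
    (exp F).coeff w =
      ∑ k ∈ Finset.range (w.length + 1), (F ^ k).coeff w / (k.factorial : ℚ) := by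
  refine finsum_eq_finsetSum_of_support_subset _ fun k hk => ?_
  by_contra hc
  simp only [Finset.coe_range, Set.mem_Iio, not_lt] at hc
  exact hk (by simp [coeff_pow_eq_zero F hF k w (by omega)])

theorem coeff_log (F : NCSeries) (hF : F.coeff [] = 1) (w : List Letter) :
    (log F).coeff w = ∑ k ∈ Finset.range w.length,
      (-1 : ℚ) ^ k / ((k : ℚ) + 1) * ((F - 1) ^ (k + 1)).coeff w := by
  have h0 : (F - 1).coeff [] = 0 := by
    change F.coeff [] - 1 = 0
    rw [hF, sub_self]
  refine finsum_eq_finsetSum_of_support_subset _ fun k hk => ?_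
  by_contra hc
  simp only [Finset.coe_range, Set.mem_Iio, not_lt] at hc
  exact hk (by simp [coeff_pow_eq_zero (F - 1) h0 (k + 1) w (by omega)])

end NCSeries

/-- The Baker--Campbell--Hausdorff series `H = log (e^A e^B)`. -/
noncomputable def bchSeries : NCSeries :=
  NCSeries.log (NCSeries.exp (NCSeries.X Letter.A) * NCSeries.exp (NCSeries.X Letter.B))

/-- The coefficient `h_w` in `H` of the word `w = w_1 ⋯ w_n` of length `n`. -/
noncomputable def bchCoeff {n : ℕ} (w : Fin n → Letter) : ℚ :=
  bchSeries.coeff (List.ofFn w)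

/-- The sum `s_p(n)` of the base-`p` digits of `n`. -/
def digitSum (p n : ℕ) : ℕ := (Nat.digits p n).sum

/-- `l(n,p) = ⌊log_p (s_p(n))⌋`. -/
def lExp (n p : ℕ) : ℕ := Nat.log p (digitSum p n)

/-- `d_n`, the product of `p ^ l(n,p)` over the primes `p < n`. -/
def dFactor (n : ℕ) : ℕ := ∏ p ∈ (Finset.range n).filter Nat.Prime, p ^ lExp n p

/-- `D` is a common denominator of all coefficients of words of length `n` in the
Baker--Campbell--Hausdorff series: a positive integer such that `D * h_w` is always an integer. -/
def IsCommonDenom (n D : ℕ) : Prop :=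
  0 < D ∧ ∀ w : Fin n → Letter, ∃ z : ℤ, (D : ℚ) * bchCoeff w = (z : ℚ)

/-!
Write `s = s_p(n)`, `l = l(n,p)`, and let `H = ∑ (-1) ^ (k + 1) / k * (e^A e^B - 1) ^ k`. Everything
is a statement about one prime `p` at a time: the smallest `p`-adic valuation of a coefficient of a
word of length `n` in `H` is `-(v_p(n!) + l)`.

*Lower bound for the valuations* (`coeff_bchSeries_mem_valGe`). By Legendre's formula,
`(p - 1) * v_p(n!) = n - s`, the coefficients `c` of `(e^A e^B - 1) ^ k` satisfy
`(p - 1) * v_p(c) ≥ max(k, s) - n`; both bounds are additive enough in the length to be proved by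
multiplying out. Since `s < p ^ (l + 1)`, division by `k` costs at most `l` factors `p` beyond `n!`.

*Sharpness* (`exists_coeff_not_mem_valGe`). A word consists of runs of lengths `q_1, …, q_m`, and
the generating function of its coefficients in the powers of `e^A e^B - 1` is
`(1 + 1 / X) ^ f * ∏ ω_{q_i} / q_i!`, where `ω_q = ∑ r! S(q, r) X ^ r` is the Fubini polynomial
and `f` is the number of places where `A` is followed by `B` (`X_pow_mul_powGen_runWord`).
Modulo `p`, the polynomial `ω_q` depends only on `q` modulo `p - 1`, by Fermat's little theorem
(`fubini_zmod_add_mul`). Hence `n` can be written as a sum of run lengths, obtained by adding up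
powers of `p`, such that `∏ ω_{q_i}` is congruent to `X ^ m (1 + 2 X) ^ t` and has small degree.
Only the term `k = p ^ l` then has valuation `-l` after multiplication by `∏ q_i!`, provided
that a certain coefficient of `(1 + 1 / X) ^ f X ^ m (1 + 2 X) ^ t` does not vanish modulo `p`. This
can be achieved by varying `m` and the last letter, because of the identity
`(1 + 2 X) ^ 2 - 4 X (1 + X) = 1` (`exists_coeff_ne_zero`).

The term `k = p ^ (l + 1)` may interfere if `s > p ^ (l + 1) - p`. In that case one power of `p` in
the base `p` expansion of `n` is split into `p` smaller ones. Then `∏ q_i!` loses one factor `p`,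
and `k = p ^ (l + 1)` becomes the decisive term (`exists_coeff_bchSeries_not_mem_valGe`).
-/

/-! ### Digit sums and weighted `p`-adic valuations -/

/-- Legendre's formula. -/
theorem sub_one_mul_padicValNat_factorial_int (p : ℕ) [hp : Fact p.Prime] (n : ℕ) :
    ((p : ℤ) - 1) * padicValNat p n.factorial = n - digitSum p n := by
  have h1 := sub_one_mul_padicValNat_factorial (p := p) n
  have h2 : (p.digits n).sum ≤ n := Nat.digit_sum_le p n
  have h3 := hp.out.one_lt
  have h4 : (((p - 1 : ℕ) : ℤ)) * padicValNat p n.factorial = ((n - (p.digits n).sum : ℕ) : ℤ) := by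
    exact_mod_cast h1
  rw [Nat.cast_sub h2, Nat.cast_sub h3.le] at h4
  simpa [digitSum] using h4

theorem digitSum_add_le (p : ℕ) [Fact p.Prime] (a b : ℕ) :
    digitSum p (a + b) ≤ digitSum p a + digitSum p b := by
  have h1 := sub_one_mul_padicValNat_factorial_int p (a + b)
  have h2 := sub_one_mul_padicValNat_factorial_int p a
  have h3 := sub_one_mul_padicValNat_factorial_int p b
  have h4 : padicValNat p a.factorial + padicValNat p b.factorial
      ≤ padicValNat p (a + b).factorial := by
    rw [← padicValNat.mul (Nat.factorial_ne_zero a) (Nat.factorial_ne_zero b)]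
    exact (padicValNat_dvd_iff_le (Nat.factorial_ne_zero _)).1
      (pow_padicValNat_dvd.trans (Nat.factorial_mul_factorial_dvd_factorial_add a b))
  have h5 : (1 : ℤ) ≤ (p : ℤ) - 1 := by
    have := (Fact.out : p.Prime).two_le
    omega
  have h6 : ((padicValNat p a.factorial : ℤ) + padicValNat p b.factorial)
      ≤ padicValNat p (a + b).factorial := by exact_mod_cast h4
  have h7 := mul_le_mul_of_nonneg_left h6 (by omega : (0 : ℤ) ≤ (p : ℤ) - 1)
  rw [mul_add, h1, h2, h3] at h7
  omega

@[simp] theorem digitSum_zero (p : ℕ) : digitSum p 0 = 0 := by simp [digitSum]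

theorem digitSum_of_lt {p n : ℕ} (h : n < p) : digitSum p n = n := by
  rcases Nat.eq_zero_or_pos n with rfl | hn
  · simp
  · simp [digitSum, Nat.digits_of_lt p n hn.ne' h]

theorem digitSum_eq_mod_add_div {p : ℕ} (hp : 1 < p) (n : ℕ) :
    digitSum p n = n % p + digitSum p (n / p) := by
  rcases Nat.eq_zero_or_pos n with rfl | hn
  · simp
  · simp [digitSum, Nat.digits_def' hp hn]

theorem digitSum_pow {p : ℕ} (hp : 1 < p) (a : ℕ) : digitSum p (p ^ a) = 1 := by
  induction a with
  | zero => simp [digitSum_of_lt hp]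
  | succ a ih =>
    rw [digitSum_eq_mod_add_div hp, pow_succ, Nat.mul_mod_left,
      Nat.mul_div_cancel _ (by omega), ih]

theorem digitSum_pos {p n : ℕ} (hp : 1 < p) (hn : 0 < n) : 0 < digitSum p n := by
  induction n using Nat.strong_induction_on with
  | _ n ih =>
    rw [digitSum_eq_mod_add_div hp]
    by_cases h : n < p
    · rw [Nat.mod_eq_of_lt h]
      omega
    · have := ih (n / p) (Nat.div_lt_self hn hp) (Nat.div_pos (by omega) (by omega))
      omega

theorem digitSum_lt_self {p n : ℕ} [hp : Fact p.Prime] (h : p ≤ n) : digitSum p n < n := by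
  have h1 := sub_one_mul_padicValNat_factorial_int p n
  have h2 : 1 ≤ padicValNat p n.factorial :=
    one_le_padicValNat_of_dvd (Nat.factorial_ne_zero n) (Nat.dvd_factorial hp.out.pos h)
  have h3 := hp.out.two_le
  have h4 : (0 : ℤ) < ((p : ℤ) - 1) * padicValNat p n.factorial :=
    mul_pos (by omega) (by omega)
  omega

/-- The rationals `x` with `a ≤ (p - 1) * v_p(x)`, where `v_p(0) = ∞`. The factor `p - 1` is the
one of Legendre's formula: it makes the bounds for coefficients of words additive in the length
of the word. -/
def valGe (p : ℕ) [hp : Fact p.Prime] (a : ℤ) : AddSubgroup ℚ where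
  carrier := {x | x ≠ 0 → a ≤ ((p : ℤ) - 1) * padicValRat p x}
  zero_mem' := fun h => absurd rfl h
  neg_mem' := by
    intro x hx h
    rw [padicValRat.neg]
    exact hx (neg_ne_zero.1 h)
  add_mem' := by
    intro x y hx hy h
    have hp1 : (0 : ℤ) ≤ (p : ℤ) - 1 := by
      have := hp.out.one_lt
      omega
    rcases eq_or_ne x 0 with rfl | hx0
    · simpa using hy (by simpa using h)
    rcases eq_or_ne y 0 with rfl | hy0
    · simpa using hx hx0
    rcases min_le_iff.1 (padicValRat.min_le_padicValRat_add (p := p) h) with h' | h'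
    · exact (hx hx0).trans (mul_le_mul_of_nonneg_left h' hp1)
    · exact (hy hy0).trans (mul_le_mul_of_nonneg_left h' hp1)

section valGe

variable {p : ℕ} [hp : Fact p.Prime]

theorem mem_valGe {a : ℤ} {x : ℚ} :
    x ∈ valGe p a ↔ (x ≠ 0 → a ≤ ((p : ℤ) - 1) * padicValRat p x) := Iff.rfl

theorem valGe_anti {a b : ℤ} (h : a ≤ b) {x : ℚ} (hx : x ∈ valGe p b) : x ∈ valGe p a :=
  fun h0 => h.trans (hx h0)

theorem mul_mem_valGe {a b c : ℤ} (h : c ≤ a + b) {x y : ℚ} (hx : x ∈ valGe p a)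
    (hy : y ∈ valGe p b) : x * y ∈ valGe p c := by
  intro h0
  have hx0 := left_ne_zero_of_mul h0
  have hy0 := right_ne_zero_of_mul h0
  rw [padicValRat.mul hx0 hy0, mul_add]
  exact h.trans (add_le_add (hx hx0) (hy hy0))

theorem natCast_mem_valGe (n : ℕ) {a : ℤ} (h : a ≤ ((p : ℤ) - 1) * padicValNat p n) :
    (n : ℚ) ∈ valGe p a := fun _ => by rwa [padicValRat.of_nat]

theorem inv_natCast_mem_valGe (n : ℕ) {a : ℤ} (h : a ≤ -(((p : ℤ) - 1) * padicValNat p n)) :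
    ((n : ℚ))⁻¹ ∈ valGe p a := fun _ => by
  rw [padicValRat.inv, padicValRat.of_nat]
  linarith

theorem sub_one_pos_int : (0 : ℤ) < (p : ℤ) - 1 := by
  have := hp.out.one_lt
  omega

theorem intCast_mem_valGe (z : ℤ) {a : ℤ} (h : a ≤ 0) : (z : ℚ) ∈ valGe p a := fun _ => by
  rw [padicValRat.of_int]
  exact h.trans (mul_nonneg sub_one_pos_int.le (by positivity))

theorem intCast_mem_valGe_of_dvd {z : ℤ} (hz : (p : ℤ) ∣ z) : (z : ℚ) ∈ valGe p ((p : ℤ) - 1) := by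
  obtain ⟨y, rfl⟩ := hz
  push_cast
  refine mul_mem_valGe (a := (p : ℤ) - 1) (b := 0) (by simp) (natCast_mem_valGe p ?_)
    (intCast_mem_valGe y le_rfl)
  simp

/-- Valuations are integers, so a bound can be rounded up to the next multiple of `p - 1`. -/
theorem valGe_round {b : ℤ} {x : ℚ} (hx : x ∈ valGe p (((p : ℤ) - 1) * b + 1)) :
    x ∈ valGe p (((p : ℤ) - 1) * (b + 1)) := by
  intro h0
  have h1 := hx h0
  have h2 : b < padicValRat p x :=
    lt_of_mul_lt_mul_left (show ((p : ℤ) - 1) * b < _ by linarith) sub_one_pos_int.le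
  exact mul_le_mul_of_nonneg_left (by omega) sub_one_pos_int.le

theorem inv_factorial_mem_valGe (n : ℕ) {a : ℤ} (h : a ≤ digitSum p n - n) :
    ((n.factorial : ℚ))⁻¹ ∈ valGe p a := by
  apply inv_natCast_mem_valGe
  rw [sub_one_mul_padicValNat_factorial_int]
  linarith

/-- The growth estimate that makes the factors `1 / k` with `k` divisible by a high power of `p`
harmless. -/
theorem sub_one_mul_le_pow_sub_pow (l d : ℕ) :
    ((p : ℤ) - 1) * d ≤ (p : ℤ) ^ (l + d) - (p : ℤ) ^ l := by
  have h1 : (1 : ℤ) ≤ p := by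
    have := hp.out.one_lt
    omega
  induction d with
  | zero => simp
  | succ d ih =>
    have h2 : (1 : ℤ) ≤ (p : ℤ) ^ (l + d) := one_le_pow₀ h1
    rw [← add_assoc, pow_succ]
    push_cast
    nlinarith

end valGe

/-! ### Coefficients of the powers of `e^A e^B - 1` -/

namespace NCSeries

theorem coeff_one (w : List Letter) : (1 : NCSeries).coeff w = if w = [] then 1 else 0 := rfl

theorem coeff_sub (F G : NCSeries) (w : List Letter) :
    (F - G).coeff w = F.coeff w - G.coeff w := rfl

theorem coeff_mul (F G : NCSeries) (w : List Letter) :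
    (F * G).coeff w = ∑ i ∈ Finset.range (w.length + 1),
      F.coeff (w.take i) * G.coeff (w.drop i) := rfl

theorem pow_zero (F : NCSeries) : F ^ 0 = 1 := rfl

theorem pow_succ (F : NCSeries) (k : ℕ) : F ^ (k + 1) = F ^ k * F := rfl

theorem coeff_X (a : Letter) (w : List Letter) : (X a).coeff w = if w = [a] then 1 else 0 := rfl

theorem coeff_X_pow (a : Letter) (k : ℕ) (w : List Letter) :
    (X a ^ k).coeff w = if w = List.replicate k a then 1 else 0 := by
  induction k generalizing w with
  | zero => simp [pow_zero, coeff_one]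
  | succ k ih =>
    rw [pow_succ, coeff_mul]
    simp only [ih, coeff_X]
    split_ifs with h
    · subst h
      rw [Finset.sum_eq_single k]
      · simp [List.take_replicate, List.drop_replicate]
      · intro i hi hik
        rw [if_neg, zero_mul]
        intro h
        have := congrArg List.length h
        simp at this hi
        omega
      · simp
    · refine Finset.sum_eq_zero fun i _ => ?_
      by_cases h1 : w.take i = List.replicate k a
      · rw [if_neg (c := w.drop i = [a]), mul_zero]
        intro h2
        apply h
        rw [← List.take_append_drop i w, h1, h2, List.replicate_succ']
      · rw [if_neg h1, zero_mul]

theorem coeff_exp_X (a : Letter) (w : List Letter) :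
    (exp (X a)).coeff w =
      if w = List.replicate w.length a then ((w.length.factorial : ℚ))⁻¹ else 0 := by
  rw [coeff_exp _ (by simp [coeff_X])]
  rw [Finset.sum_eq_single w.length]
  · rw [coeff_X_pow]
    split_ifs <;> simp
  · intro k _ hk
    rw [coeff_X_pow, if_neg, zero_div]
    intro h
    have := congrArg List.length h
    simp at this
    omega
  · simp

theorem coeff_exp_X_eq_zero {a b : Letter} (hab : b ≠ a) {w : List Letter} (h : b ∈ w) :
    (exp (X a)).coeff w = 0 := by
  rw [coeff_exp_X, if_neg]
  intro hw
  rw [hw] at h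
  exact hab (List.eq_of_mem_replicate h)

end NCSeries

open NCSeries in
/-- The series `e^A e^B`. -/
noncomputable def expMulExp : NCSeries := exp (X Letter.A) * exp (X Letter.B)

section

open Letter NCSeries

theorem coeff_expMulExp (w : List Letter) :
    expMulExp.coeff w = ∑ i ∈ Finset.range (w.length + 1),
      (exp (X A)).coeff (w.take i) * (exp (X B)).coeff (w.drop i) := rfl

theorem coeff_expMulExp_nil : expMulExp.coeff [] = 1 := by
  simp [coeff_expMulExp, coeff_exp_X]

theorem coeff_expMulExp_append_eq_zero {x y : List Letter} (hx : B ∈ x) (hy : A ∈ y) :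
    expMulExp.coeff (x ++ y) = 0 := by
  rw [coeff_expMulExp]
  refine Finset.sum_eq_zero fun k _ => ?_
  rcases le_total k x.length with h | h
  · rw [coeff_exp_X_eq_zero (a := B) (b := A) (by decide), mul_zero]
    rw [List.drop_append_of_le_length h]
    exact List.mem_append_right _ hy
  · rw [coeff_exp_X_eq_zero (a := A) (b := B) (by decide), zero_mul]
    rw [List.take_append, List.take_of_length_le h]
    exact List.mem_append_left _ hx

theorem coeff_expMulExp_replicate_append (i j : ℕ) :
    expMulExp.coeff (List.replicate i A ++ List.replicate j B) =
      ((i.factorial : ℚ))⁻¹ * ((j.factorial : ℚ))⁻¹ := by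
  rw [coeff_expMulExp, Finset.sum_eq_single i]
  · rw [List.take_left' (by simp), List.drop_left' (by simp)]
    simp [coeff_exp_X]
  · intro k hk hki
    simp only [List.length_append, List.length_replicate, Finset.mem_range] at hk
    rcases lt_or_gt_of_ne hki with h | h
    · rw [coeff_exp_X_eq_zero (a := B) (b := A) (by decide), mul_zero]
      rw [List.drop_append_of_le_length (by simp; omega), List.drop_replicate]
      exact List.mem_append_left _ (List.mem_replicate.2 ⟨by omega, rfl⟩)
    · rw [coeff_exp_X_eq_zero (a := A) (b := B) (by decide), zero_mul]
      rw [List.take_append]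
      refine List.mem_append_right _ ?_
      rw [List.length_replicate, List.take_replicate]
      exact List.mem_replicate.2 ⟨by omega, rfl⟩
  · intro h
    simp only [List.length_append, List.length_replicate, Finset.mem_range] at h
    omega

theorem coeff_expMulExp_replicate (a : Letter) (q : ℕ) :
    expMulExp.coeff (List.replicate q a) = ((q.factorial : ℚ))⁻¹ := by
  cases a
  · simpa using coeff_expMulExp_replicate_append q 0
  · simpa using coeff_expMulExp_replicate_append 0 q

/-- A bound for the coefficients of `e^A e^B` by length which is subadditive in the length passes
to all powers of `e^A e^B - 1`. -/
theorem coeff_pow_mem_valGe {p : ℕ} [Fact p.Prime] (ρ : ℕ → ℤ) (c : ℤ) (h0 : ρ 0 ≤ 0)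
    (hadd : ∀ m n, 0 < n → ρ (m + n) ≤ ρ m + ρ n)
    (hρ : ∀ i j, 0 < i + j → ρ (i + j) + c ≤ digitSum p i - i + (digitSum p j - j))
    (k : ℕ) (w : List Letter) :
    ((expMulExp - 1) ^ k).coeff w ∈ valGe p (ρ w.length + k * c) := by
  induction k generalizing w with
  | zero =>
    rw [pow_zero, coeff_one]
    split_ifs with h
    · subst h
      have := natCast_mem_valGe (p := p) 1 (a := ρ 0) (by simpa using h0)
      simpa using this
    · exact zero_mem _
  | succ k ih =>
    rw [pow_succ, coeff_mul]
    refine sum_mem fun i hi => ?_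
    have hi' : i ≤ w.length := by
      rw [Finset.mem_range] at hi
      omega
    obtain ⟨u, v, rfl, rfl⟩ : ∃ u v, w = u ++ v ∧ i = u.length :=
      ⟨w.take i, w.drop i, by simp, by simpa using hi'⟩
    rw [List.take_left, List.drop_left]
    rcases v.eq_nil_or_concat with rfl | ⟨v', a, hv⟩
    · simp [coeff_sub, coeff_one, coeff_expMulExp_nil]
    · have hpos : 0 < v.length := by simp [hv]
      have hne : v ≠ [] := List.length_pos_iff.1 hpos
      have hadd' := hadd u.length v.length hpos
      refine mul_mem_valGe (b := ρ v.length + c) ?_ (ih u) ?_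
      · rw [List.length_append]
        push_cast
        linarith
      · rw [coeff_sub, coeff_one, if_neg hne, sub_zero, coeff_expMulExp]
        refine sum_mem fun j hj => ?_
        have hj' : j ≤ v.length := by
          rw [Finset.mem_range] at hj
          omega
        obtain ⟨x, y, rfl, rfl⟩ : ∃ x y, v = x ++ y ∧ j = x.length :=
          ⟨v.take j, v.drop j, by simp, by simpa using hj'⟩
        rw [List.take_left, List.drop_left, coeff_exp_X, coeff_exp_X]
        rw [List.length_append] at hpos ⊢
        refine mul_mem_valGe (hρ _ _ hpos) ?_ ?_
        · split_ifs
          · exact inv_factorial_mem_valGe _ le_rfl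
          · exact zero_mem _
        · split_ifs
          · exact inv_factorial_mem_valGe _ le_rfl
          · exact zero_mem _

theorem coeff_pow_mem_valGe_sub_length {p : ℕ} [hp : Fact p.Prime] (k : ℕ) (w : List Letter) :
    ((expMulExp - 1) ^ k).coeff w ∈ valGe p (k - w.length) := by
  have h := coeff_pow_mem_valGe (p := p) (fun n => -(n : ℤ)) 1 (by simp)
    (fun m n _ => by push_cast; linarith) (fun i j hij => ?_) k w
  · exact valGe_anti (by linarith) h
  · have h1 : 0 < digitSum p i + digitSum p j := by
      rcases Nat.eq_zero_or_pos i with hi | hi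
      · have := digitSum_pos hp.out.one_lt (show 0 < j by omega)
        omega
      · have := digitSum_pos hp.out.one_lt hi
        omega
    push_cast
    omega

theorem coeff_pow_mem_valGe_digitSum {p : ℕ} [hp : Fact p.Prime] (k : ℕ) (w : List Letter) :
    ((expMulExp - 1) ^ k).coeff w ∈ valGe p (digitSum p w.length - w.length) := by
  have key : ∀ m n : ℕ, ((digitSum p (m + n) : ℕ) : ℤ) - ((m + n : ℕ) : ℤ)
      ≤ digitSum p m - m + (digitSum p n - n) := fun m n => by
    have := digitSum_add_le p m n
    push_cast
    omega
  have h := coeff_pow_mem_valGe (p := p) (fun n => (digitSum p n : ℤ) - n) 0 (by simp)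
    (fun m n _ => key m n) (fun i j _ => by simpa using key i j) k w
  exact valGe_anti (by simp) h

theorem coeff_bchSeries (w : List Letter) :
    bchSeries.coeff w = ∑ k ∈ Finset.range w.length,
      (-1 : ℚ) ^ k / ((k : ℚ) + 1) * ((expMulExp - 1) ^ (k + 1)).coeff w :=
  coeff_log expMulExp coeff_expMulExp_nil w

/-- The `p`-part of the denominator of a coefficient of a word of length `n` is at most that of
`n! * p ^ l(n,p)`. If `p ^ e ∣ k` with `e > l(n,p)`, then the multinomial coefficients in the
coefficient of the word in `n! (e^A e^B - 1) ^ k` are divisible by `p ^ (e - l(n,p))`. -/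
theorem coeff_bchSeries_mem_valGe {p : ℕ} [hp : Fact p.Prime] (w : List Letter) :
    bchSeries.coeff w ∈
      valGe p (-(((p : ℤ) - 1) * (padicValNat p w.length.factorial + lExp w.length p))) := by
  rw [coeff_bchSeries]
  refine sum_mem fun k _ => ?_
  set n := w.length
  set c := ((expMulExp - 1) ^ (k + 1)).coeff w with hc
  have hL := sub_one_mul_padicValNat_factorial_int p n
  set l := lExp n p with hl
  set v := padicValNat p n.factorial
  have hs : digitSum p n < p ^ (l + 1) := Nat.lt_pow_succ_log_self hp.out.one_lt _
  set e := padicValNat p (k + 1) with he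
  have hcoef : (-1 : ℚ) ^ k / ((k : ℚ) + 1) ∈ valGe p (-(((p : ℤ) - 1) * e)) := by
    rw [div_eq_mul_inv]
    refine mul_mem_valGe (a := 0) (zero_add _).ge ?_ ?_
    · have := intCast_mem_valGe (p := p) ((-1) ^ k) le_rfl
      exact_mod_cast this
    · have := inv_natCast_mem_valGe (p := p) (k + 1) (a := -(((p : ℤ) - 1) * e)) le_rfl
      exact_mod_cast this
  rcases le_or_gt e l with hel | hel
  · refine mul_mem_valGe ?_ hcoef (coeff_pow_mem_valGe_digitSum (k + 1) w)
    have : ((p : ℤ) - 1) * e ≤ ((p : ℤ) - 1) * l :=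
      mul_le_mul_of_nonneg_left (by exact_mod_cast hel) sub_one_pos_int.le
    linarith
  · obtain ⟨d, hd⟩ := Nat.exists_eq_add_of_lt hel
    have hk : p ^ e ≤ k + 1 := Nat.le_of_dvd (by omega) pow_padicValNat_dvd
    have hpow := sub_one_mul_le_pow_sub_pow (p := p) (l + 1) d
    rw [show l + 1 + d = e by omega] at hpow
    have hk' : (p : ℤ) ^ e ≤ k + 1 := by exact_mod_cast hk
    have hs' : (digitSum p n : ℤ) + 1 ≤ (p : ℤ) ^ (l + 1) := by exact_mod_cast hs
    have hmem : c ∈ valGe p (((p : ℤ) - 1) * ((d : ℤ) - v) + 1) := by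
      refine valGe_anti ?_ (coeff_pow_mem_valGe_sub_length (k + 1) w)
      push_cast
      linarith
    refine mul_mem_valGe ?_ hcoef (valGe_round hmem)
    rw [hd]
    push_cast
    linarith

end

/-! ### Fubini polynomials -/

section

open PowerSeries

/-- The `q`-th Fubini polynomial `∑ r, r! S(q, r) X ^ r` (with `S` the Stirling numbers of the
second kind), as a power series over `R`. The number `r! S(q, r)` enters as the `r`-th forward
difference of `j ↦ j ^ q` at `0`, which only depends on the function `j ↦ j ^ q` with values
in `R`. -/
noncomputable def fubini (R : Type*) [CommRing R] (q : ℕ) : PowerSeries R :=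
  PowerSeries.mk fun r => (fwdDiff 1)^[r] (fun j : ℕ => (j : R) ^ q) 0

theorem coeff_fubini (R : Type*) [CommRing R] (q r : ℕ) :
    coeff r (fubini R q) = (fwdDiff 1)^[r] (fun j : ℕ => (j : R) ^ q) 0 := coeff_mk _ _

theorem fubini_zero (R : Type*) [CommRing R] : fubini R 0 = 1 := by
  ext r
  rw [coeff_fubini, PowerSeries.coeff_one]
  rcases r with _ | r
  · simp
  · have h : fwdDiff 1 (fun j : ℕ => (j : R) ^ 0) = fun _ => 0 := by
      ext j
      simp [fwdDiff]
    rw [Function.iterate_succ_apply, h, if_neg (Nat.succ_ne_zero r)]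
    clear h
    induction r with
    | zero => rfl
    | succ r ih =>
      rw [Function.iterate_succ_apply]
      have h : fwdDiff 1 (fun _ : ℕ => (0 : R)) = fun _ => 0 := by
        ext j
        simp [fwdDiff]
      rw [h, ih]

theorem fubini_recurrence (R : Type*) [CommRing R] {q : ℕ} (hq : 0 < q) :
    fubini R q = X * ∑ i ∈ Finset.range q, C (q.choose i : R) * fubini R i := by
  ext r
  rcases r with _ | r
  · simp [coeff_fubini, hq.ne']
  · rw [coeff_succ_X_mul, coeff_fubini, Function.iterate_succ_apply, map_sum]
    have h : fwdDiff 1 (fun j : ℕ => (j : R) ^ q) =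
        ∑ i ∈ Finset.range q, (q.choose i : R) • fun j : ℕ => (j : R) ^ i := by
      ext j
      simp [fwdDiff, add_pow, Finset.sum_range_succ, mul_comm]
    rw [h, fwdDiff_iter_finsetSum, Finset.sum_apply]
    refine Finset.sum_congr rfl fun i _ => ?_
    rw [fwdDiff_iter_const_smul, coeff_C_mul, coeff_fubini]
    rfl

theorem map_fubini {R S : Type*} [CommRing R] [CommRing S] (φ : R →+* S) (q : ℕ) :
    PowerSeries.map φ (fubini R q) = fubini S q := by
  have key : ∀ (r : ℕ) (f : ℕ → R) (n : ℕ),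
      φ ((fwdDiff 1)^[r] f n) = (fwdDiff 1)^[r] (fun j => φ (f j)) n := by
    intro r
    induction r with
    | zero => intro f n; rfl
    | succ r ih =>
      intro f n
      have h : (fun j => φ (fwdDiff 1 f j)) = fwdDiff 1 fun j => φ (f j) := by
        funext j
        simp [fwdDiff]
      rw [Function.iterate_succ_apply, Function.iterate_succ_apply, ih, h]
  ext r
  rw [coeff_map, coeff_fubini, coeff_fubini, key]
  simp

/-- The exponential generating version `fubini q / q!`; it satisfies
`∑ q, fubiniDiv q * t ^ q = 1 / (1 - X * (e ^ t - 1))`. -/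
noncomputable def fubiniDiv (q : ℕ) : PowerSeries ℚ :=
  C ((q.factorial : ℚ)⁻¹) * fubini ℚ q

theorem fubiniDiv_zero : fubiniDiv 0 = 1 := by simp [fubiniDiv, fubini_zero]

theorem fubiniDiv_recurrence {q : ℕ} (hq : 0 < q) :
    fubiniDiv q = X * ∑ i ∈ Finset.range q,
      fubiniDiv i * C (((q - i).factorial : ℚ)⁻¹) := by
  rw [fubiniDiv, fubini_recurrence ℚ hq, mul_left_comm, Finset.mul_sum]
  congr 1
  refine Finset.sum_congr rfl fun i hi => ?_
  have hi' : i ≤ q := (Finset.mem_range.1 hi).le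
  rw [fubiniDiv, ← mul_assoc, ← map_mul, mul_right_comm, ← map_mul, Nat.cast_choose ℚ hi']
  congr 2
  have h1 : (q.factorial : ℚ) ≠ 0 := by exact_mod_cast q.factorial_ne_zero
  field_simp

theorem fubini_one (R : Type*) [CommRing R] : fubini R 1 = X := by
  simp [fubini_recurrence R one_pos, fubini_zero]

theorem fubini_two (R : Type*) [CommRing R] : fubini R 2 = X * (1 + 2 * X) := by
  rw [fubini_recurrence R two_pos, show (2 : ℕ) = 1 + 1 from rfl, Finset.sum_range_succ,
    Finset.sum_range_one]
  simp [fubini_zero, fubini_one, map_ofNat (C (R := R)) 2]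

/-- By Fermat's little theorem, the Fubini polynomials modulo `p` are periodic with
period `p - 1`. -/
theorem fubini_zmod_add_mul {p : ℕ} [Fact p.Prime] {q : ℕ} (hq : 0 < q) (c : ℕ) :
    fubini (ZMod p) (q + (p - 1) * c) = fubini (ZMod p) q := by
  have h : (fun j : ℕ => (j : ZMod p) ^ (q + (p - 1) * c)) = fun j : ℕ => (j : ZMod p) ^ q := by
    funext j
    rcases eq_or_ne (j : ZMod p) 0 with h | h
    · rw [h, zero_pow hq.ne', zero_pow (by omega)]
    · rw [pow_add, pow_mul, ZMod.pow_card_sub_one_eq_one h, one_pow, mul_one]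
  ext r
  rw [coeff_fubini, coeff_fubini, h]

end

/-! ### Words as sequences of runs -/

section

open PowerSeries Letter

/-- The generating function of the coefficients of a word `w` in the powers of `e^A e^B - 1`,
that is, the coefficient of `w` in `1 / (1 - X (e^A e^B - 1))`. -/
noncomputable def powGen (w : List Letter) : PowerSeries ℚ :=
  PowerSeries.mk fun k => ((expMulExp - 1) ^ k).coeff w

theorem coeff_powGen (w : List Letter) (k : ℕ) :
    coeff k (powGen w) = ((expMulExp - 1) ^ k).coeff w := coeff_mk _ _

theorem powGen_nil : powGen [] = 1 := by
  ext k
  rw [coeff_powGen, PowerSeries.coeff_one]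
  rcases k with _ | k
  · simp [NCSeries.pow_zero, NCSeries.coeff_one]
  · rw [NCSeries.coeff_pow_eq_zero _ (by simp [NCSeries.coeff_sub, NCSeries.coeff_one,
      coeff_expMulExp_nil]) _ _ (by simp), if_neg (Nat.succ_ne_zero k)]

/-- Splitting off the last of the nonempty factors of a word. -/
theorem powGen_recurrence {w : List Letter} (hw : w ≠ []) :
    powGen w = X * ∑ i ∈ Finset.range w.length,
      powGen (w.take i) * C (expMulExp.coeff (w.drop i)) := by
  ext k
  rcases k with _ | k
  · simp [coeff_powGen, NCSeries.pow_zero, NCSeries.coeff_one, hw]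
  · rw [coeff_powGen, coeff_succ_X_mul, map_sum, NCSeries.pow_succ, NCSeries.coeff_mul,
      Finset.sum_range_succ]
    simp only [List.take_length, List.drop_length, NCSeries.coeff_sub, NCSeries.coeff_one,
      coeff_expMulExp_nil, if_true, sub_self, mul_zero, add_zero]
    refine Finset.sum_congr rfl fun i hi => ?_
    rw [coeff_mul_C, coeff_powGen, if_neg, sub_zero]
    rw [Finset.mem_range] at hi
    intro h
    have := congrArg List.length h
    simp at this
    omega

theorem sum_take_drop_append {M : Type*} [AddCommMonoid M] (f : List Letter → List Letter → M)
    (u v : List Letter) :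
    ∑ i ∈ Finset.range (u ++ v).length, f ((u ++ v).take i) ((u ++ v).drop i) =
      ∑ i ∈ Finset.range u.length, f (u.take i) (u.drop i ++ v) +
        ∑ i ∈ Finset.range v.length, f (u ++ v.take i) (v.drop i) := by
  rw [List.length_append, Finset.sum_range_add]
  congr 1
  · refine Finset.sum_congr rfl fun i hi => ?_
    have hi' := (Finset.mem_range.1 hi).le
    rw [List.take_append_of_le_length hi', List.drop_append_of_le_length hi']
  · refine Finset.sum_congr rfl fun i _ => ?_
    rw [List.take_length_add_append, List.drop_length_add_append]

theorem sum_take_drop_replicate {M : Type*} [AddCommMonoid M] (f : List Letter → List Letter → M)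
    (u : List Letter) (a : Letter) (q : ℕ) :
    ∑ i ∈ Finset.range (List.replicate q a).length,
        f (u ++ (List.replicate q a).take i) ((List.replicate q a).drop i) =
      ∑ i ∈ Finset.range q, f (u ++ List.replicate i a) (List.replicate (q - i) a) := by
  rw [List.length_replicate]
  refine Finset.sum_congr rfl fun i hi => ?_
  rw [List.take_replicate, List.drop_replicate, min_eq_left (Finset.mem_range.1 hi).le]

theorem mem_drop_concat {M : Type*} (x : List M) (b : M) {i : ℕ} (hi : i < (x ++ [b]).length) :
    b ∈ (x ++ [b]).drop i := by
  rw [List.length_append, List.length_singleton] at hi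
  rw [List.drop_append_of_le_length (by omega)]
  simp

/-- A run appended to a word contributes a factor `fubiniDiv q` if no factor of the form
`A^i B^j` can straddle its beginning. -/
theorem powGen_append_replicate_of_eq_zero (v : List Letter) (a : Letter)
    (h0 : ∀ q, 0 < q → ∀ i < v.length, expMulExp.coeff (v.drop i ++ List.replicate q a) = 0)
    (q : ℕ) : powGen (v ++ List.replicate q a) = powGen v * fubiniDiv q := by
  induction q using Nat.strong_induction_on with
  | _ q ih =>
    rcases Nat.eq_zero_or_pos q with rfl | hq
    · simp [fubiniDiv_zero]
    rw [powGen_recurrence (by simp; omega),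
      sum_take_drop_append (fun x y => powGen x * C (R := ℚ) (expMulExp.coeff y)),
      sum_take_drop_replicate (fun x y => powGen x * C (R := ℚ) (expMulExp.coeff y)),
      Finset.sum_eq_zero, zero_add, fubiniDiv_recurrence hq, mul_left_comm (powGen v),
      Finset.mul_sum _ _ (powGen v)]
    · congr 1
      refine Finset.sum_congr rfl fun i hi => ?_
      rw [ih i (Finset.mem_range.1 hi), coeff_expMulExp_replicate, mul_assoc]
    · intro i hi
      rw [h0 q hq i (Finset.mem_range.1 hi), map_zero, mul_zero]

/-- A run of `B`s after a run of `A`s contributes `(1 + X) / X * fubiniDiv q`, because the last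
factor of the first run and the first factor of the second run may be merged. -/
theorem X_mul_powGen_append_replicate (v : List Letter)
    (hv : ∀ i < v.length, B ∈ v.drop i) {j : ℕ} (hj : 0 < j) {q : ℕ} (hq : 0 < q) :
    X * powGen (v ++ List.replicate j A ++ List.replicate q B) =
      (1 + X) * powGen (v ++ List.replicate j A) * fubiniDiv q := by
  set u := v ++ List.replicate j A with hu
  have hzero : ∀ q : ℕ, ∀ i < v.length,
      expMulExp.coeff (v.drop i ++ (List.replicate j A ++ List.replicate q B)) = 0 :=
    fun q i hi => coeff_expMulExp_append_eq_zero (hv i hi)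
      (List.mem_append_left _ (List.mem_replicate.2 ⟨hj.ne', rfl⟩))
  have hA : powGen u = X * ∑ i ∈ Finset.range j,
      powGen (v ++ List.replicate i A) * C (((j - i).factorial : ℚ)⁻¹) := by
    rw [hu, powGen_recurrence (by simp; omega),
      sum_take_drop_append (fun x y => powGen x * C (R := ℚ) (expMulExp.coeff y)),
      sum_take_drop_replicate (fun x y => powGen x * C (R := ℚ) (expMulExp.coeff y)),
      Finset.sum_eq_zero, zero_add]
    · simp only [coeff_expMulExp_replicate]
    · intro i hi
      have := hzero 0 i (Finset.mem_range.1 hi)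
      rw [List.replicate_zero, List.append_nil] at this
      rw [this, map_zero, mul_zero]
  have hrec : ∀ q, 0 < q → powGen (u ++ List.replicate q B) =
      powGen u * C ((q.factorial : ℚ)⁻¹) + X * ∑ i ∈ Finset.range q,
        powGen (u ++ List.replicate i B) * C (((q - i).factorial : ℚ)⁻¹) := by
    intro q hq
    rw [powGen_recurrence (by simp; omega),
      sum_take_drop_append (fun x y => powGen x * C (R := ℚ) (expMulExp.coeff y)),
      sum_take_drop_replicate (fun x y => powGen x * C (R := ℚ) (expMulExp.coeff y)),
      hu, sum_take_drop_append (fun x y => powGen x *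
        C (expMulExp.coeff (y ++ List.replicate q B))),
      sum_take_drop_replicate (fun x y => powGen x *
        C (expMulExp.coeff (y ++ List.replicate q B))), ← hu,
      Finset.sum_eq_zero, zero_add, hA, mul_add, mul_assoc X, Finset.sum_mul]
    · congr 2
      · refine Finset.sum_congr rfl fun i _ => ?_
        rw [coeff_expMulExp_replicate_append, map_mul, mul_assoc]
      · simp only [coeff_expMulExp_replicate]
    · intro i hi
      rw [List.append_assoc, hzero q i (Finset.mem_range.1 hi), map_zero, mul_zero]
  induction q using Nat.strong_induction_on with
  | _ q ih =>
    obtain ⟨q, rfl⟩ : ∃ q', q = q' + 1 := ⟨q - 1, by omega⟩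
    have h1 : ∀ i ∈ Finset.range q,
        X * (powGen (u ++ List.replicate (i + 1) B) *
          C (((q + 1 - (i + 1)).factorial : ℚ)⁻¹)) =
        (1 + X) * powGen u * (fubiniDiv (i + 1) *
          C (((q + 1 - (i + 1)).factorial : ℚ)⁻¹)) := by
      intro i hi
      rw [← mul_assoc, ih (i + 1) (by have := Finset.mem_range.1 hi; omega) (by omega), mul_assoc]
    rw [hrec _ hq, fubiniDiv_recurrence hq, Finset.sum_range_succ', Finset.sum_range_succ',
      mul_add X (∑ i ∈ Finset.range q, _) _, Finset.mul_sum, Finset.sum_congr rfl h1,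
      ← Finset.mul_sum, fubiniDiv_zero]
    simp only [List.replicate_zero, List.append_nil, Nat.sub_zero]
    ring

/-- The other letter. -/
def Letter.swap : Letter → Letter
  | A => B
  | B => A

/-- The word with run lengths `qs`, listed from the last run to the first, whose last letter
is `a`. -/
def runWord : Letter → List ℕ → List Letter
  | _, [] => []
  | a, q :: qs => runWord a.swap qs ++ List.replicate q a

theorem length_runWord (a : Letter) (qs : List ℕ) : (runWord a qs).length = qs.sum := by
  induction qs generalizing a with
  | nil => rfl
  | cons q qs ih => simp [runWord, ih, add_comm]

/-- The number of places in `runWord a qs` where a run of `A`s is followed by a run of `B`s, for a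
list `qs` of `m` positive numbers. -/
def numAB : Letter → ℕ → ℕ
  | A, m => (m - 1) / 2
  | B, m => m / 2

theorem mem_drop_runWord {a : Letter} {qs : List ℕ} (hqs : ∀ q ∈ qs, 0 < q) :
    ∀ i < (runWord a qs).length, a ∈ (runWord a qs).drop i := by
  intro i hi
  cases qs with
  | nil => simp [runWord] at hi
  | cons q qs =>
    obtain ⟨q, rfl⟩ : ∃ q', q = q' + 1 := ⟨q - 1, by have := hqs q (by simp); omega⟩
    rw [runWord, List.replicate_succ', ← List.append_assoc] at hi ⊢
    exact mem_drop_concat _ _ hi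

/-- Goldberg's product formula for the coefficients of a word in terms of its run lengths. -/
theorem X_pow_mul_powGen_runWord (a : Letter) (qs : List ℕ) (hqs : ∀ q ∈ qs, 0 < q) :
    X ^ numAB a qs.length * powGen (runWord a qs) =
      (1 + X) ^ numAB a qs.length * (qs.map fubiniDiv).prod := by
  induction qs generalizing a with
  | nil => cases a <;> simp [runWord, powGen_nil, numAB]
  | cons q qs ih =>
    have hqs' : ∀ q ∈ qs, 0 < q := fun q hq => hqs q (List.mem_cons_of_mem _ hq)
    have hq : 0 < q := hqs q (by simp)
    cases a with
    | A =>
      have h := powGen_append_replicate_of_eq_zero (runWord B qs) A (fun q hq i hi =>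
        coeff_expMulExp_append_eq_zero (mem_drop_runWord hqs' i hi)
          (List.mem_replicate.2 ⟨hq.ne', rfl⟩)) q
      have h2 : numAB A (q :: qs).length = numAB B qs.length := by simp [numAB]
      rw [runWord, Letter.swap, h, h2, ← mul_assoc, ih B hqs', List.map_cons, List.prod_cons]
      ring
    | B =>
      cases qs with
      | nil =>
        have h := powGen_append_replicate_of_eq_zero [] B (by simp) q
        simpa [runWord, numAB, powGen_nil] using h
      | cons j qs =>
        have hqs'' : ∀ q ∈ qs, 0 < q := fun q hq => hqs' q (List.mem_cons_of_mem _ hq)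
        have h := X_mul_powGen_append_replicate (runWord B qs) (mem_drop_runWord hqs'')
          (hqs' j (by simp)) hq
        have h2 : numAB B (q :: j :: qs).length = numAB A (j :: qs).length + 1 := by
          simp [numAB]
          omega
        have h3 := ih A hqs'
        rw [runWord, Letter.swap] at h3
        rw [runWord, Letter.swap, runWord, Letter.swap, h2, pow_succ, mul_assoc, h,
          List.map_cons, List.prod_cons, pow_succ]
        linear_combination (1 + X) * fubiniDiv q * h3

end

/-! ### A nonvanishing coefficient -/

section

open PowerSeries Letter

theorem coeff_eq_zero_of_lt {K : Type*} [CommRing K] {f m t k : ℕ} (hk : m + t < k) :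
    coeff (k + f) ((1 + X) ^ f * (X ^ m * (1 + 2 * X) ^ t) : PowerSeries K) = 0 := by
  have h : ((1 + X) ^ f * (X ^ m * (1 + 2 * X) ^ t) : PowerSeries K) =
      (((1 + Polynomial.X) ^ f * (Polynomial.X ^ m * (1 + Polynomial.C 2 * Polynomial.X) ^ t) :
        Polynomial K) : PowerSeries K) := by
    push_cast
    rw [map_ofNat]
  rw [h, Polynomial.coeff_coe]
  apply Polynomial.coeff_eq_zero_of_natDegree_lt
  have h1 : (1 + Polynomial.X : Polynomial K).natDegree ≤ 1 := by compute_degree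
  have h2 : (1 + Polynomial.C 2 * Polynomial.X : Polynomial K).natDegree ≤ 1 := by compute_degree
  have h3 := Polynomial.natDegree_pow_le_of_le f h1
  have h4 := Polynomial.natDegree_pow_le_of_le t h2
  have h5 := Polynomial.natDegree_mul_le_of_le h3
    (Polynomial.natDegree_mul_le_of_le (Polynomial.natDegree_X_pow_le (R := K) m) h4)
  omega

theorem coeff_one_add_X_pow_self (K : Type*) [CommRing K] (f : ℕ) :
    coeff f ((1 + X) ^ f : PowerSeries K) = 1 := by
  have h : ((1 + X) ^ f : PowerSeries K) =
      (((1 + Polynomial.X) ^ f : Polynomial K) : PowerSeries K) := by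
    push_cast
    rfl
  rw [h, Polynomial.coeff_coe, Polynomial.coeff_one_add_X_pow, Nat.choose_self, Nat.cast_one]

/-- Since `1 = (1 + 2 X) ^ 2 - 4 X (1 + X)`, the polynomial `X ^ (N - f) (1 + X) ^ f` with nonzero
`N`-th coefficient is a combination of the polynomials considered here. -/
theorem exists_coeff_ne_zero_even (K : Type*) [CommRing K] [Nontrivial K] {N f : ℕ} (hf : f ≤ N)
    (u : ℕ) : ∃ i ≤ u, coeff N
      (X ^ (N - f + i) * (1 + X) ^ (f + i) * (1 + 2 * X) ^ (2 * (u - i)) : PowerSeries K) ≠ 0 := by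
  by_contra! hall
  have h1 : coeff N (X ^ (N - f) * (1 + X) ^ f : PowerSeries K) = 1 := by
    rw [coeff_X_pow_mul', if_pos (Nat.sub_le N f), Nat.sub_sub_self hf, coeff_one_add_X_pow_self]
  have h2 : (X ^ (N - f) * (1 + X) ^ f : PowerSeries K) = ∑ i ∈ Finset.range (u + 1),
      C ((-4) ^ i * (u.choose i : K)) *
        (X ^ (N - f + i) * (1 + X) ^ (f + i) * (1 + 2 * X) ^ (2 * (u - i))) := by
    have h3 : (1 : PowerSeries K) = (-4 * (X * (1 + X)) + (1 + 2 * X) ^ 2) ^ u := by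
      rw [show (-4 * (X * (1 + X)) + (1 + 2 * X) ^ 2 : PowerSeries K) = 1 by ring, one_pow]
    have h4 : (X ^ (N - f) * (1 + X) ^ f : PowerSeries K) =
        X ^ (N - f) * (1 + X) ^ f * (-4 * (X * (1 + X)) + (1 + 2 * X) ^ 2) ^ u := by
      rw [← h3, mul_one]
    rw [h4, add_pow (-4 * (X * (1 + X))), Finset.mul_sum]
    refine Finset.sum_congr rfl fun i _ => ?_
    rw [map_mul, map_pow, map_neg, map_ofNat, map_natCast, pow_mul,
      mul_pow (-4 : PowerSeries K), mul_pow X]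
    ring
  rw [h2, map_sum, Finset.sum_eq_zero] at h1
  · exact zero_ne_one h1
  · intro i hi
    rw [coeff_C_mul, hall i (by have := Finset.mem_range.1 hi; omega), mul_zero]

/-- For a word with `m` runs and last letter `a` whose Fubini polynomials are `X (1 + 2 X)`
(`t` times) and `X` over `K`, the series of `X_pow_mul_powGen_runWord` has the `N`-th coefficient
considered here. It is nonzero for some choice of `a`, `m ≥ N` and `t` with `m + t = N + r`. -/
theorem exists_coeff_ne_zero (K : Type*) [CommRing K] [Nontrivial K] {N r : ℕ}
    (h : Even r ∨ Odd N) : ∃ (a : Letter) (m t : ℕ), N ≤ m ∧ m + t = N + r ∧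
      coeff (N + numAB a m)
        ((1 + X) ^ numAB a m * (X ^ m * (1 + 2 * X) ^ t) : PowerSeries K) ≠ 0 := by
  have shift : ∀ (f m t : ℕ), f ≤ m →
      coeff (N + f) ((1 + X) ^ f * (X ^ m * (1 + 2 * X) ^ t) : PowerSeries K) =
        coeff N (X ^ (m - f) * (1 + X) ^ f * (1 + 2 * X) ^ t : PowerSeries K) := by
    intro f m t hfm
    rw [← coeff_X_pow_mul _ f N]
    congr 1
    obtain ⟨d, rfl⟩ := Nat.exists_eq_add_of_le hfm
    rw [Nat.add_sub_cancel_left]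
    ring
  rcases Nat.even_or_odd' r with ⟨u, hu | hu⟩
  · obtain ⟨i, hi, hne⟩ := exists_coeff_ne_zero_even K (N := N) (f := N / 2) (by omega) u
    refine ⟨B, N + 2 * i, 2 * (u - i), by omega, by omega, ?_⟩
    have hf : numAB B (N + 2 * i) = N / 2 + i := by
      simp only [numAB]
      omega
    rw [shift _ _ _ (by omega), hf, show N + 2 * i - (N / 2 + i) = N - N / 2 + i by omega]
    exact hne
  · have hN : Odd N := h.resolve_left (by rw [Nat.not_even_iff_odd]; exact ⟨u, hu⟩)
    obtain ⟨c, hc⟩ := hN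
    obtain ⟨i, hi, hne⟩ := exists_coeff_ne_zero_even K (N := N) (f := c) (by omega) u
    -- For `m` even, the words ending in `B` and in `A` lead to two different polynomials, whose
    -- difference is the polynomial found for `m - 1` runs.
    have hsub : (X ^ (N - c + i) * (1 + X) ^ (c + i) * (1 + 2 * X) ^ (2 * (u - i)) :
        PowerSeries K) =
        X ^ (c + i + 1) * (1 + X) ^ (c + i + 1) * (1 + 2 * X) ^ (2 * (u - i)) -
          X ^ (c + i + 2) * (1 + X) ^ (c + i) * (1 + 2 * X) ^ (2 * (u - i)) := by
      rw [show N - c + i = c + i + 1 by omega]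
      ring
    rw [hsub, map_sub] at hne
    by_cases hB : coeff N (X ^ (c + i + 1) * (1 + X) ^ (c + i + 1) * (1 + 2 * X) ^ (2 * (u - i)) :
        PowerSeries K) = 0
    · rw [hB, zero_sub, neg_ne_zero] at hne
      refine ⟨A, N + 2 * i + 1, 2 * (u - i), by omega, by omega, ?_⟩
      have hf : numAB A (N + 2 * i + 1) = c + i := by
        simp only [numAB]
        omega
      rw [shift _ _ _ (by omega), hf, show N + 2 * i + 1 - (c + i) = c + i + 2 by omega]
      exact hne
    · refine ⟨B, N + 2 * i + 1, 2 * (u - i), by omega, by omega, ?_⟩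
      have hf : numAB B (N + 2 * i + 1) = c + i + 1 := by
        simp only [numAB]
        omega
      rw [shift _ _ _ (by omega), hf, show N + 2 * i + 1 - (c + i + 1) = c + i + 1 by omega]
      exact hB

end

/-! ### Choice of the run lengths -/

section

open PowerSeries

theorem exists_list_pow_length_digitSum {p : ℕ} (hp : 1 < p) (n : ℕ) :
    ∃ l : List ℕ, (∀ x ∈ l, ∃ a, x = p ^ a) ∧ l.length = digitSum p n ∧ l.sum = n := by
  induction n using Nat.strong_induction_on with
  | _ n ih =>
    rcases Nat.eq_zero_or_pos n with rfl | hn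
    · exact ⟨[], by simp, by simp, rfl⟩
    obtain ⟨l, hl, hlen, hsum⟩ := ih (n / p) (Nat.div_lt_self hn hp)
    refine ⟨List.replicate (n % p) 1 ++ l.map (p * ·), ?_, ?_, ?_⟩
    · intro x hx
      rcases List.mem_append.1 hx with hx | hx
      · exact ⟨0, by rw [List.eq_of_mem_replicate hx, pow_zero]⟩
      · obtain ⟨y, hy, rfl⟩ := List.mem_map.1 hx
        obtain ⟨a, rfl⟩ := hl y hy
        exact ⟨a + 1, by rw [pow_succ, mul_comm]⟩
    · rw [digitSum_eq_mod_add_div hp]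
      simp [hlen]
    · rw [List.sum_append, List.sum_map_mul_left, List.map_id', hsum]
      simp [Nat.mod_add_div]

/-- One summand `p ^ (a + 1)` in the digit expansion is replaced by `p` summands `p ^ a`. -/
theorem exists_list_pow_length_digitSum_add {p n : ℕ} [hp : Fact p.Prime] (hn : p ≤ n) :
    ∃ l : List ℕ, (∀ x ∈ l, ∃ a, x = p ^ a) ∧ l.length = digitSum p n + (p - 1) ∧ l.sum = n := by
  obtain ⟨l, hl, hlen, hsum⟩ := exists_list_pow_length_digitSum hp.out.one_lt n
  have hp2 := hp.out.two_le
  obtain ⟨x, hx, hx1⟩ : ∃ x ∈ l, x ≠ 1 := by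
    by_contra! h
    have h1 : l.sum = l.length := by
      rw [List.eq_replicate_of_mem h]
      simp
    have := digitSum_lt_self hn
    omega
  obtain ⟨s, t, rfl⟩ := List.append_of_mem hx
  obtain ⟨a, rfl⟩ := hl x hx
  obtain ⟨a, rfl⟩ : ∃ b, a = b + 1 := ⟨a - 1, by
    rcases a with _ | a
    · exact absurd (pow_zero p) hx1
    · rfl⟩
  refine ⟨List.replicate p (p ^ a) ++ (s ++ t), ?_, ?_, ?_⟩
  · intro y hy
    simp only [List.mem_append] at hy
    rcases hy with hy | hy | hy
    · exact ⟨a, List.eq_of_mem_replicate hy⟩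
    · exact hl y (by simp [hy])
    · exact hl y (by simp [hy])
  · simp only [List.length_append, List.length_cons, List.length_replicate] at hlen ⊢
    omega
  · simp only [List.sum_append, List.sum_cons, List.sum_replicate, smul_eq_mul] at hsum ⊢
    rw [pow_succ, mul_comm] at hsum
    omega

theorem exists_pow_eq_one_add_mul {p : ℕ} (hp : 0 < p) (a : ℕ) :
    ∃ c, p ^ a = 1 + (p - 1) * c := by
  obtain ⟨p, rfl⟩ : ∃ d, p = d + 1 := ⟨p - 1, by omega⟩
  induction a with
  | zero => exact ⟨0, rfl⟩
  | succ a ih =>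
    obtain ⟨c, hc⟩ := ih
    rw [Nat.add_sub_cancel] at hc
    refine ⟨1 + (p + 1) * c, ?_⟩
    rw [pow_succ, hc, Nat.add_sub_cancel]
    ring

theorem digitSum_list_sum_le (p : ℕ) [Fact p.Prime] (l : List ℕ) :
    digitSum p l.sum ≤ (l.map (digitSum p)).sum := by
  induction l with
  | nil => simp
  | cons a l ih =>
    rw [List.sum_cons, List.map_cons, List.sum_cons]
    exact (digitSum_add_le p a l.sum).trans (by omega)

theorem exists_list_sum_eq_length_add_mul {d : ℕ} {l : List ℕ} (hl : ∀ x ∈ l, ∃ c, x = 1 + d * c) :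
    ∃ c, l.sum = l.length + d * c := by
  induction l with
  | nil => exact ⟨0, rfl⟩
  | cons a l ih =>
    obtain ⟨c, hc⟩ := ih fun x hx => hl x (List.mem_cons_of_mem _ hx)
    obtain ⟨b, hb⟩ := hl a (by simp)
    refine ⟨b + c, ?_⟩
    rw [List.sum_cons, List.length_cons, hc, hb]
    ring

/-- Adding up `p` numbers congruent to `1` modulo `p - 1` gives a number congruent to `1`, so the
length of a list of such numbers can be lowered by any multiple of `p - 1`. -/
theorem exists_list_shorten {p : ℕ} [hp : Fact p.Prime] {M : ℕ} (hM : 0 < M) (j : ℕ) (l : List ℕ)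
    (hl : ∀ x ∈ l, ∃ c, x = 1 + (p - 1) * c) (hlen : l.length = M + (p - 1) * j) :
    ∃ l' : List ℕ, (∀ x ∈ l', ∃ c, x = 1 + (p - 1) * c) ∧ l'.length = M ∧ l'.sum = l.sum ∧
      (l'.map (digitSum p)).sum ≤ (l.map (digitSum p)).sum := by
  have hp2 := hp.out.two_le
  induction j generalizing l with
  | zero => exact ⟨l, hl, by simpa using hlen, rfl, le_rfl⟩
  | succ j ih =>
    rw [mul_add, mul_one] at hlen
    have hpl : p ≤ l.length := by omega
    have htake : (l.take p).length = p := by simp [hpl]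
    have hsplit : l.sum = (l.take p).sum + (l.drop p).sum := by
      rw [← List.sum_append, List.take_append_drop]
    have hdig : (l.map (digitSum p)).sum =
        ((l.take p).map (digitSum p)).sum + ((l.drop p).map (digitSum p)).sum := by
      rw [← List.sum_append, ← List.map_append, List.take_append_drop]
    have hgood : ∀ x ∈ (l.take p).sum :: l.drop p, ∃ c, x = 1 + (p - 1) * c := by
      intro x hx
      rcases List.mem_cons.1 hx with rfl | hx
      · obtain ⟨c, hc⟩ := exists_list_sum_eq_length_add_mul
          fun x hx => hl x (List.mem_of_mem_take hx)
        refine ⟨1 + c, ?_⟩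
        rw [hc, htake, mul_add, mul_one]
        omega
      · exact hl x (List.mem_of_mem_drop hx)
    have hlength : ((l.take p).sum :: l.drop p).length = M + (p - 1) * j := by
      rw [List.length_cons, List.length_drop]
      omega
    obtain ⟨l', h1, h2, h3, h4⟩ := ih _ hgood hlength
    refine ⟨l', h1, h2, by rw [h3, List.sum_cons, hsplit], h4.trans ?_⟩
    rw [List.map_cons, List.sum_cons, hdig]
    exact Nat.add_le_add_right (digitSum_list_sum_le p _) _

/-- Adding up `t` pairs in a list of numbers congruent to `1` modulo `p - 1` gives run lengths
whose Fubini polynomials are congruent to `X (1 + 2 X)` (`t` times) and `X`. -/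
theorem exists_list_pairs {p : ℕ} [hp : Fact p.Prime] {m t : ℕ} (htm : t ≤ m) (l : List ℕ)
    (hl : ∀ x ∈ l, ∃ c, x = 1 + (p - 1) * c) (hlen : l.length = m + t) :
    ∃ q : List ℕ, (∀ x ∈ q, 0 < x) ∧ q.length = m ∧ q.sum = l.sum ∧
      (q.map (digitSum p)).sum ≤ (l.map (digitSum p)).sum ∧
      (q.map (fubini (ZMod p))).prod = X ^ m * (1 + 2 * X) ^ t := by
  induction t generalizing m l with
  | zero =>
    refine ⟨l, ?_, hlen, rfl, le_rfl, ?_⟩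
    · intro x hx
      obtain ⟨c, rfl⟩ := hl x hx
      omega
    · rw [List.map_congr_left (g := fun _ => X)]
      · simp [hlen]
      · intro x hx
        obtain ⟨c, rfl⟩ := hl x hx
        rw [fubini_zmod_add_mul one_pos, fubini_one]
  | succ t ih =>
    obtain ⟨m, rfl⟩ : ∃ m', m = m' + 1 := ⟨m - 1, by omega⟩
    rcases l with _ | ⟨a, _ | ⟨b, l⟩⟩
    · simp at hlen
    · simp at hlen
      omega
    · simp only [List.length_cons] at hlen
      obtain ⟨q, h1, h2, h3, h4, h5⟩ := ih (m := m) (by omega) l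
        (fun x hx => hl x (by simp [hx])) (by omega)
      obtain ⟨c, hc⟩ := hl a (by simp)
      obtain ⟨d, hd⟩ := hl b (by simp)
      have hab : a + b = 2 + (p - 1) * (c + d) := by
        rw [hc, hd]
        ring
      refine ⟨(a + b) :: q, ?_, by simp [h2], by simp [h3, add_assoc], ?_, ?_⟩
      · intro x hx
        rcases List.mem_cons.1 hx with rfl | hx
        · omega
        · exact h1 x hx
      · have := digitSum_add_le p a b
        simp only [List.map_cons, List.sum_cons]
        omega
      · rw [List.map_cons, List.prod_cons, h5, hab, fubini_zmod_add_mul two_pos, fubini_two]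
        ring

end

/-! ### Words with large denominators -/

section

open PowerSeries Letter

theorem sub_one_mul_padicValNat_prod_factorial (p : ℕ) [Fact p.Prime] (q : List ℕ) :
    ((p : ℤ) - 1) * padicValNat p (q.map Nat.factorial).prod =
      q.sum - (q.map (digitSum p)).sum := by
  induction q with
  | nil => simp
  | cons a q ih =>
    have h : (q.map Nat.factorial).prod ≠ 0 := by
      simp [List.prod_eq_zero_iff, Nat.factorial_ne_zero]
    have h1 := sub_one_mul_padicValNat_factorial_int p a
    rw [List.map_cons, List.prod_cons, padicValNat.mul (Nat.factorial_ne_zero a) h,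
      List.map_cons, List.sum_cons, List.sum_cons]
    rw [Nat.cast_add, Nat.cast_add, Nat.cast_add, mul_add]
    linarith

theorem C_prod_factorial_mul_prod_fubiniDiv (q : List ℕ) :
    C (((q.map Nat.factorial).prod : ℕ) : ℚ) * (q.map fubiniDiv).prod =
      (q.map (fubini ℚ)).prod := by
  induction q with
  | nil => simp
  | cons a q ih =>
    have h : C ((a.factorial : ℕ) : ℚ) * fubiniDiv a = fubini ℚ a := by
      rw [fubiniDiv, ← mul_assoc, ← map_mul, mul_inv_cancel₀, map_one, one_mul]
      exact_mod_cast a.factorial_ne_zero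
    rw [List.map_cons, List.prod_cons, List.map_cons, List.prod_cons, List.map_cons,
      List.prod_cons, Nat.cast_mul, map_mul, ← h, ← ih]
    ring

/-- The `k`-th coefficient of `∏ fubini q_i * (1 + 1 / X) ^ f` with `f = numAB a m`: the
coefficient of `runWord a q` in `(e^A e^B - 1) ^ k` up to the factor `∏ q_i!`. -/
noncomputable def runCoeff (a : Letter) (q : List ℕ) (k : ℕ) : ℤ :=
  coeff (k + numAB a q.length) ((1 + X) ^ numAB a q.length * (q.map (fubini ℤ)).prod)

theorem map_list_prod_fubini {R : Type*} [CommRing R] (φ : ℤ →+* R) (q : List ℕ) :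
    PowerSeries.map φ (q.map (fubini ℤ)).prod = (q.map (fubini R)).prod := by
  rw [map_list_prod, List.map_map]
  congr 1
  exact List.map_congr_left fun x _ => map_fubini φ x

theorem cast_runCoeff {R : Type*} [CommRing R] (a : Letter) (q : List ℕ) (k : ℕ) :
    ((runCoeff a q k : ℤ) : R) = coeff (k + numAB a q.length)
      ((1 + X) ^ numAB a q.length * (q.map (fubini R)).prod) := by
  have h := coeff_map (Int.castRingHom R) (k + numAB a q.length)
    ((1 + X) ^ numAB a q.length * (q.map (fubini ℤ)).prod)
  rw [map_mul, map_list_prod_fubini] at h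
  simpa [runCoeff] using h.symm

theorem prod_factorial_mul_coeff_pow (a : Letter) (q : List ℕ) (hq : ∀ x ∈ q, 0 < x) (k : ℕ) :
    (((q.map Nat.factorial).prod : ℕ) : ℚ) * ((expMulExp - 1) ^ k).coeff (runWord a q) =
      (runCoeff a q k : ℚ) := by
  rw [cast_runCoeff, ← C_prod_factorial_mul_prod_fubiniDiv, mul_left_comm,
    ← X_pow_mul_powGen_runWord a q hq, mul_left_comm, coeff_X_pow_mul, coeff_C_mul, coeff_powGen]

/-- Main estimate from below. If `n` is a sum of `S` powers of `p` and
`p ^ L ≤ S ≤ p ^ (L + 1) - p`, then some word of length `n` has a coefficient of valuation at most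
`-L - (n - S) / (p - 1)`. For this word, the contribution of `(e^A e^B - 1) ^ k` is negligible
for all `k ≠ p ^ L`. -/
theorem exists_coeff_not_mem_valGe {p : ℕ} [hp : Fact p.Prime] {L : ℕ} {l : List ℕ}
    (hl : ∀ x ∈ l, ∃ a, x = p ^ a) (hL : p ^ L ≤ l.length) (hL' : l.length + p ≤ p ^ (L + 1)) :
    ∃ w : List Letter, w.length = l.sum ∧ bchSeries.coeff w ∉
      valGe p (-(((p : ℤ) - 1) * L) - ((l.sum : ℤ) - l.length) + 1) := by
  have hp2 := hp.out.two_le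
  have hp1 : (1 : ℤ) ≤ (p : ℤ) - 1 := by omega
  set N := p ^ L with hN
  have hNpos : 0 < N := Nat.pow_pos hp.out.pos
  set S := l.length with hS
  have hLpos : L ≠ 0 := by
    rintro rfl
    rw [zero_add, pow_one] at hL'
    omega
  have hpN : p ≤ N := Nat.le_self_pow hLpos p
  set r := (S - N) % (p - 1) with hr
  have hrlt : r < p - 1 := Nat.mod_lt _ (by omega)
  have hdiv : r + (p - 1) * ((S - N) / (p - 1)) = S - N := Nat.mod_add_div _ _
  have hpar : Even r ∨ Odd N := by
    rcases hp.out.eq_two_or_odd' with h2 | hodd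
    · left
      rw [show r = 0 by omega]
      exact Even.zero
    · exact Or.inr hodd.pow
  obtain ⟨a, m, t, hNm, hmt, hne⟩ := exists_coeff_ne_zero (ZMod p) hpar
  obtain ⟨l₁, h1good, h1len, h1sum, h1dig⟩ := exists_list_shorten (p := p) (M := m + t) (by omega)
    ((S - N) / (p - 1)) l (fun x hx => by
      obtain ⟨b, rfl⟩ := hl x hx
      exact exists_pow_eq_one_add_mul hp.out.pos b) (by omega)
  obtain ⟨q, hqpos, hqlen, hqsum, hqdig, hqprod⟩ :=
    exists_list_pairs (p := p) (m := m) (t := t) (by omega) l₁ h1good h1len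
  have hldig : (l.map (digitSum p)).sum = S := by
    rw [List.map_congr_left (g := fun _ => 1)]
    · simp [hS]
    · intro x hx
      obtain ⟨b, rfl⟩ := hl x hx
      exact digitSum_pow hp.out.one_lt b
  set n := l.sum with hn
  have hwlen : (runWord a q).length = n := by rw [length_runWord, hqsum, h1sum]
  have hNn : N ≤ n := by
    have : q.length ≤ q.sum := List.length_le_sum_of_one_le q fun x hx => hqpos x hx
    omega
  refine ⟨runWord a q, hwlen, fun hmem => ?_⟩
  set Q := (q.map Nat.factorial).prod with hQ
  set c := runCoeff a q with hc
  have hQval : (n : ℤ) - S ≤ ((p : ℤ) - 1) * padicValNat p Q := by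
    rw [hQ, sub_one_mul_padicValNat_prod_factorial, hqsum, h1sum]
    have : ((q.map (digitSum p)).sum : ℤ) ≤ S := by
      exact_mod_cast (hqdig.trans h1dig).trans hldig.le
    linarith
  have hcZ : ∀ k, ((c k : ℤ) : ZMod p) = coeff (k + numAB a m)
      ((1 + X) ^ numAB a m * (X ^ m * (1 + 2 * X) ^ t)) := by
    intro k
    rw [hc, cast_runCoeff, hqlen, hqprod]
  have hsum : (Q : ℚ) * bchSeries.coeff (runWord a q) =
      ∑ k ∈ Finset.range n, (-1 : ℚ) ^ k / ((k : ℚ) + 1) * (c (k + 1) : ℚ) := by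
    rw [coeff_bchSeries, hwlen, Finset.mul_sum]
    refine Finset.sum_congr rfl fun k _ => ?_
    rw [mul_left_comm, prod_factorial_mul_coeff_pow a q hqpos]
  have hbound : ∀ k : ℕ, (c k : ℚ) ∈ valGe p ((k : ℤ) - S) := by
    intro k
    rw [hc, ← prod_factorial_mul_coeff_pow a q hqpos]
    refine mul_mem_valGe ?_ (natCast_mem_valGe Q hQval)
      (coeff_pow_mem_valGe_sub_length k (runWord a q))
    rw [hwlen]
    linarith
  have hcoef : ∀ k : ℕ, (-1 : ℚ) ^ k / ((k : ℚ) + 1) ∈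
      valGe p (-(((p : ℤ) - 1) * padicValNat p (k + 1))) := by
    intro k
    rw [div_eq_mul_inv]
    refine mul_mem_valGe (a := 0) (zero_add _).ge ?_ ?_
    · have := intCast_mem_valGe (p := p) ((-1) ^ k) le_rfl
      exact_mod_cast this
    · have := inv_natCast_mem_valGe (p := p) (k + 1) le_rfl
      exact_mod_cast this
  have hterm : ∀ k : ℕ, k + 1 ≠ N → (-1 : ℚ) ^ k / ((k : ℚ) + 1) * (c (k + 1) : ℚ) ∈
      valGe p (-(((p : ℤ) - 1) * L) + 1) := by
    intro k hk
    have hdvd : p ^ padicValNat p (k + 1) ∣ k + 1 := pow_padicValNat_dvd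
    have hk1 := hcoef k
    set e := padicValNat p (k + 1)
    rcases lt_trichotomy e L with he | he | he
    · refine mul_mem_valGe ?_ hk1 (intCast_mem_valGe (p := p) (c (k + 1)) le_rfl)
      have : ((p : ℤ) - 1) * ((e : ℤ) + 1) ≤ ((p : ℤ) - 1) * L :=
        mul_le_mul_of_nonneg_left (by exact_mod_cast he) (by linarith)
      linarith
    · rw [he] at hdvd hk1
      obtain ⟨u, hu⟩ := hdvd
      have hu2 : 2 ≤ u := by
        rcases u with _ | _ | u
        · simp at hu
        · simp only [zero_add, mul_one] at hu
          exact absurd hu hk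
        · omega
      have hlarge : N * 2 ≤ k + 1 := by
        rw [hu]
        exact Nat.mul_le_mul_left _ hu2
      have hzero : ((c (k + 1) : ℤ) : ZMod p) = 0 := by
        rw [hcZ, coeff_eq_zero_of_lt (by omega)]
      refine mul_mem_valGe ?_ hk1
        (intCast_mem_valGe_of_dvd ((ZMod.intCast_zmod_eq_zero_iff_dvd _ p).1 hzero))
      linarith
    · obtain ⟨d, hd⟩ := Nat.exists_eq_add_of_lt he
      have hk2 : p ^ e ≤ k + 1 := Nat.le_of_dvd (by omega) hdvd
      have hpow := sub_one_mul_le_pow_sub_pow (p := p) (L + 1) d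
      rw [show L + 1 + d = e by omega] at hpow
      have hk3 : (p : ℤ) ^ e ≤ k + 1 := by exact_mod_cast hk2
      have hS3 : (S : ℤ) + p ≤ (p : ℤ) ^ (L + 1) := by exact_mod_cast hL'
      refine mul_mem_valGe ?_ hk1 (hbound (k + 1))
      rw [hd]
      push_cast
      linarith
  have hQh : (Q : ℚ) * bchSeries.coeff (runWord a q) ∈ valGe p (-(((p : ℤ) - 1) * L) + 1) :=
    mul_mem_valGe (by linarith) (natCast_mem_valGe Q hQval) hmem
  rw [hsum, ← Finset.add_sum_erase _ _ (Finset.mem_range.2 (show N - 1 < n by omega))] at hQh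
  have hrest : ∑ k ∈ (Finset.range n).erase (N - 1),
      (-1 : ℚ) ^ k / ((k : ℚ) + 1) * (c (k + 1) : ℚ) ∈ valGe p (-(((p : ℤ) - 1) * L) + 1) :=
    sum_mem fun k hk => hterm k (by have := Finset.ne_of_mem_erase hk; omega)
  have hmain := ((valGe p _).add_mem_cancel_right hrest).1 hQh
  rw [Nat.sub_add_cancel hNpos] at hmain
  -- Multiplying the remaining term by `± p ^ L` shows that `p` divides `c N`.
  have hcN : (c N : ℚ) ∈ valGe p 1 := by
    have h1 : (((-1) ^ (N - 1) * N : ℤ) : ℚ) ∈ valGe p (((p : ℤ) - 1) * L) := by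
      push_cast
      refine mul_mem_valGe (a := 0) (zero_add _).ge ?_ ?_
      · have := intCast_mem_valGe (p := p) ((-1) ^ (N - 1)) le_rfl
        exact_mod_cast this
      · refine natCast_mem_valGe N ?_
        rw [hN, padicValNat.prime_pow]
    have h2 := mul_mem_valGe (c := 1) (by linarith) h1 hmain
    have h3 : ((N - 1 : ℕ) : ℚ) + 1 = N := by
      rw [Nat.cast_sub hNpos]
      simp
    have h4 : (N : ℚ) ≠ 0 := by exact_mod_cast hNpos.ne'
    have h5 : ((-1 : ℚ) ^ (N - 1)) * (-1) ^ (N - 1) = 1 := by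
      rw [← mul_pow]
      simp
    rw [h3] at h2
    have h6 : (((-1) ^ (N - 1) * N : ℤ) : ℚ) * ((-1 : ℚ) ^ (N - 1) / N * (c N : ℚ)) = c N := by
      push_cast
      field_simp
      linear_combination (c N : ℚ) * h5
    rwa [h6] at h2
  apply hne
  rw [← hcZ, ZMod.intCast_zmod_eq_zero_iff_dvd]
  by_cases h0 : c N = 0
  · rw [h0]
    exact dvd_zero _
  · have h1 := hcN (by exact_mod_cast h0)
    rw [padicValRat.of_int] at h1
    have h2 : padicValInt p (c N) ≠ 0 := by
      intro h
      rw [h] at h1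
      simp at h1
    by_contra hnd
    exact h2 (padicValInt.eq_zero_of_not_dvd hnd)

/-- The bound of `coeff_bchSeries_mem_valGe` is attained. If `s_p(n)` is so close to
`p ^ (l + 1)` that `k = p ^ (l + 1)` could interfere, a carry is used to work with `p ^ (l + 1)`
instead of `p ^ l`. -/
theorem exists_coeff_bchSeries_not_mem_valGe {p n : ℕ} [hp : Fact p.Prime] (hn : p ≤ n) :
    ∃ w : List Letter, w.length = n ∧ bchSeries.coeff w ∉
      valGe p (-(((p : ℤ) - 1) * (padicValNat p n.factorial + lExp n p)) + 1) := by
  have hp2 := hp.out.two_le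
  have hspos : digitSum p n ≠ 0 := (digitSum_pos hp.out.one_lt (by omega)).ne'
  have hleg := sub_one_mul_padicValNat_factorial_int p n
  have hlow : p ^ lExp n p ≤ digitSum p n := Nat.pow_log_le_self p hspos
  have hhigh : digitSum p n < p ^ (lExp n p + 1) := Nat.lt_pow_succ_log_self hp.out.one_lt _
  rcases le_or_gt (digitSum p n + p) (p ^ (lExp n p + 1)) with h | h
  · obtain ⟨l, hl, hlen, hsum⟩ := exists_list_pow_length_digitSum hp.out.one_lt n
    obtain ⟨w, hw, hmem⟩ := exists_coeff_not_mem_valGe (L := lExp n p) hl (by omega) (by omega)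
    refine ⟨w, by omega, fun hw' => hmem (valGe_anti ?_ hw')⟩
    rw [hsum, hlen]
    linarith
  · obtain ⟨l, hl, hlen, hsum⟩ := exists_list_pow_length_digitSum_add hn
    have h2 : 2 * p ^ (lExp n p + 1) ≤ p ^ (lExp n p + 1 + 1) := by
      rw [pow_succ _ (lExp n p + 1), mul_comm]
      exact Nat.mul_le_mul_left _ hp2
    have h3 : (p - 1) * p ≤ (p - 1) * p ^ (lExp n p + 1) :=
      Nat.mul_le_mul_left _ (Nat.le_self_pow (Nat.succ_ne_zero _) p)
    have h4 : p ^ (lExp n p + 1 + 1) = (p - 1) * p ^ (lExp n p + 1) + p ^ (lExp n p + 1) := by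
      obtain ⟨d, rfl⟩ : ∃ d, p = d + 1 := ⟨p - 1, by omega⟩
      rw [Nat.add_sub_cancel, pow_succ _ (lExp n (d + 1) + 1)]
      ring
    have h5 : 2 * (p - 1) ≤ (p - 1) * p := by
      rw [mul_comm]
      exact Nat.mul_le_mul_left _ hp2
    obtain ⟨w, hw, hmem⟩ := exists_coeff_not_mem_valGe (L := lExp n p + 1) hl (by omega) (by omega)
    refine ⟨w, by omega, fun hw' => hmem (valGe_anti ?_ hw')⟩
    rw [hsum, hlen]
    rw [Nat.cast_add, Nat.cast_add, Nat.cast_sub hp.out.one_lt.le, Nat.cast_one]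
    linarith

end

/-! ### The smallest common denominator -/

theorem lExp_of_le {n p : ℕ} (hp : p.Prime) (h : n ≤ p) : lExp n p = 0 := by
  rw [lExp, Nat.log_eq_zero_iff]
  left
  rcases h.eq_or_lt with rfl | h
  · have := digitSum_pow hp.one_lt 1
    rw [pow_one] at this
    rw [this]
    exact hp.one_lt
  · rwa [digitSum_of_lt h]

theorem dFactor_ne_zero (n : ℕ) : dFactor n ≠ 0 := by
  refine Finset.prod_ne_zero_iff.2 fun p hp => pow_ne_zero _ ?_
  exact (Finset.mem_filter.1 hp).2.ne_zero

theorem padicValNat_dFactor {p : ℕ} [hp : Fact p.Prime] (n : ℕ) :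
    padicValNat p (dFactor n) = lExp n p := by
  rw [← Nat.factorization_def _ hp.out, dFactor, Nat.factorization_prod, Finsupp.finsetSum_apply]
  · have h : ∀ q ∈ (Finset.range n).filter Nat.Prime,
        (q ^ lExp n q).factorization p = if q = p then lExp n p else 0 := by
      intro q hq
      rw [(Finset.mem_filter.1 hq).2.factorization_pow, Finsupp.single_apply]
      split_ifs with h
      · rw [h]
      · rfl
    rw [Finset.sum_congr rfl h, Finset.sum_ite_eq']
    split_ifs with hmem
    · rfl
    · refine (lExp_of_le hp.out ?_).symm
      by_contra! hlt
      exact hmem (Finset.mem_filter.2 ⟨Finset.mem_range.2 hlt, hp.out⟩)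
  · intro q hq
    exact pow_ne_zero _ (Finset.mem_filter.1 hq).2.ne_zero

theorem padicValNat_factorial_mul_dFactor {p : ℕ} [Fact p.Prime] (n : ℕ) :
    padicValNat p (n.factorial * dFactor n) = padicValNat p n.factorial + lExp n p := by
  rw [padicValNat.mul (Nat.factorial_ne_zero n) (dFactor_ne_zero n), padicValNat_dFactor]

/-- Since numerator and denominator are coprime, `v_p` of the denominator is the negative part of
the valuation. -/
theorem padicValNat_den (p : ℕ) [hp : Fact p.Prime] (x : ℚ) :
    (padicValNat p x.den : ℤ) = max 0 (-padicValRat p x) := by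
  rw [padicValRat_def]
  by_cases h : p ∣ x.den
  · have h1 : padicValInt p x.num = 0 := by
      refine padicValInt.eq_zero_of_not_dvd fun h2 => ?_
      have h3 := Nat.dvd_gcd (Int.natCast_dvd.1 h2) h
      rw [x.reduced] at h3
      exact hp.out.one_lt.ne' (Nat.dvd_one.1 h3)
    rw [h1]
    simp
  · rw [padicValNat.eq_zero_of_not_dvd h]
    simp

theorem padicValNat_den_le_of_mem_valGe {p : ℕ} [Fact p.Prime] {x : ℚ} {b : ℕ}
    (h : x ∈ valGe p (-(((p : ℤ) - 1) * b))) : padicValNat p x.den ≤ b := by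
  rcases eq_or_ne x 0 with rfl | h0
  · simp
  have h1 := padicValNat_den p x
  have h2 : -(b : ℤ) ≤ padicValRat p x := by
    refine le_of_mul_le_mul_left ?_ (sub_one_pos_int (p := p))
    rw [mul_neg]
    exact h h0
  omega

theorem le_padicValNat_den_of_not_mem_valGe {p : ℕ} [Fact p.Prime] {x : ℚ} {b : ℕ}
    (h : x ∉ valGe p (-(((p : ℤ) - 1) * b) + 1)) : b ≤ padicValNat p x.den := by
  rw [mem_valGe, Classical.not_imp, not_le] at h
  have h1 := padicValNat_den p x
  have h2 : padicValRat p x ≤ -(b : ℤ) := by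
    refine le_of_mul_le_mul_left ?_ (sub_one_pos_int (p := p))
    rw [mul_neg]
    linarith [h.2]
  omega

theorem padicValNat_den_bchCoeff_le {p n : ℕ} [Fact p.Prime] (w : Fin n → Letter) :
    padicValNat p (bchCoeff w).den ≤ padicValNat p n.factorial + lExp n p := by
  have h := coeff_bchSeries_mem_valGe (p := p) (List.ofFn w)
  rw [List.length_ofFn] at h
  apply padicValNat_den_le_of_mem_valGe
  rw [Nat.cast_add]
  exact h

theorem exists_padicValNat_den_bchCoeff_eq (p n : ℕ) [hp : Fact p.Prime] :
    ∃ w : Fin n → Letter,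
      padicValNat p (bchCoeff w).den = padicValNat p n.factorial + lExp n p := by
  rcases lt_or_ge n p with hn | hn
  · -- Here the claimed valuation is `0`, and any word will do.
    refine ⟨fun _ => Letter.A, le_antisymm (padicValNat_den_bchCoeff_le _) ?_⟩
    rw [lExp_of_le hp.out hn.le, padicValNat.eq_zero_of_not_dvd]
    · exact Nat.zero_le _
    · rw [hp.out.dvd_factorial]
      omega
  · obtain ⟨w, rfl, hw⟩ := exists_coeff_bchSeries_not_mem_valGe hn
    refine ⟨w.get, le_antisymm (padicValNat_den_bchCoeff_le _) ?_⟩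
    apply le_padicValNat_den_of_not_mem_valGe
    rw [bchCoeff, List.ofFn_get, Nat.cast_add]
    exact hw

theorem lcm_den_bchCoeff (n : ℕ) :
    (Finset.univ : Finset (Fin n → Letter)).lcm (fun w => (bchCoeff w).den) =
      n.factorial * dFactor n := by
  have hne : n.factorial * dFactor n ≠ 0 :=
    mul_ne_zero (Nat.factorial_ne_zero n) (dFactor_ne_zero n)
  have hdvd : (Finset.univ : Finset (Fin n → Letter)).lcm (fun w => (bchCoeff w).den) ∣
      n.factorial * dFactor n := by
    refine Finset.lcm_dvd fun w _ => ?_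
    rw [← Nat.factorization_prime_le_iff_dvd (Rat.den_ne_zero _) hne]
    intro p hp
    have : Fact p.Prime := ⟨hp⟩
    rw [Nat.factorization_def _ hp, Nat.factorization_def _ hp, padicValNat_factorial_mul_dFactor]
    exact padicValNat_den_bchCoeff_le w
  have hne' := ne_zero_of_dvd_ne_zero hne hdvd
  refine Nat.dvd_antisymm hdvd ?_
  rw [← Nat.factorization_prime_le_iff_dvd hne hne']
  intro p hp
  have : Fact p.Prime := ⟨hp⟩
  obtain ⟨w, hw⟩ := exists_padicValNat_den_bchCoeff_eq p n
  rw [Nat.factorization_def _ hp, padicValNat_factorial_mul_dFactor, ← hw,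
    ← Nat.factorization_def _ hp]
  exact (Nat.factorization_le_iff_dvd (Rat.den_ne_zero _) hne').2
    (Finset.dvd_lcm (f := fun w => (bchCoeff w).den) (Finset.mem_univ w)) p

theorem exists_natCast_mul_eq_intCast_iff (D : ℕ) (x : ℚ) :
    (∃ z : ℤ, (D : ℚ) * x = z) ↔ x.den ∣ D := by
  constructor
  · rintro ⟨z, hz⟩
    have h1 : (D : ℤ) * x.num = z * x.den := by
      have h2 : (D : ℚ) * x.num = z * x.den := by
        rw [← hz, mul_assoc, Rat.mul_den_eq_num]
      exact_mod_cast h2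
    have h3 : (x.den : ℤ) ∣ D * x.num := ⟨z, by rw [h1, mul_comm]⟩
    have h4 : IsCoprime (x.den : ℤ) x.num := by
      rw [Int.isCoprime_iff_gcd_eq_one, Int.gcd_comm]
      exact x.reduced
    exact Int.natCast_dvd_natCast.1 (h4.dvd_of_dvd_mul_right h3)
  · rintro ⟨c, rfl⟩
    refine ⟨c * x.num, ?_⟩
    push_cast
    rw [← Rat.mul_den_eq_num x]
    ring

theorem isCommonDenom_iff (n D : ℕ) :
    IsCommonDenom n D ↔ 0 < D ∧ n.factorial * dFactor n ∣ D := by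
  rw [IsCommonDenom, ← lcm_den_bchCoeff, Finset.lcm_dvd_iff]
  simp only [exists_natCast_mul_eq_intCast_iff, Finset.mem_univ, true_imp_iff]

theorem theorem1 (n : ℕ) (hn : 1 ≤ n) :
    IsLeast {D : ℕ | IsCommonDenom n D} (n.factorial * dFactor n) ∧
    (Finset.univ : Finset (Fin n → Letter)).lcm (fun w => (bchCoeff w).den) =
      n.factorial * dFactor n ∧
    (∀ p : ℕ, p.Prime →
      ∃ w : Fin n → Letter,
        padicValNat p (bchCoeff w).den = padicValNat p n.factorial + lExp n p) := by
  refine ⟨⟨?_, ?_⟩, lcm_den_bchCoeff n, fun p hp => ?_⟩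
  · exact (isCommonDenom_iff n _).2
      ⟨Nat.mul_pos n.factorial_pos (Nat.pos_of_ne_zero (dFactor_ne_zero n)), dvd_rfl⟩
  · intro D hD
    obtain ⟨hD0, hD1⟩ := (isCommonDenom_iff n D).1 hD
    exact Nat.le_of_dvd hD0 hD1
  · have : Fact p.Prime := ⟨hp⟩
    exact exists_padicValNat_den_bchCoeff_eq p n
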